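/- Let $Z_+\in\mathbb R$, $\mu\in\mathbb C$, and consider the radial equation $$v''(\xi)+\bigl(k^2\cosh^2\xi+Z_+\cosh\xi-\mu\bigr)v(\xi)=0,\qquad k\in\mathbb C\setminus\{0\},$$ or, for $\tilde v(x):=v(\log(x+1))$, $x=e^{\xi}-1$, the equivalent equation $\bigl((x+1)\tilde v'\bigr)'+q\,\tilde v=0$ with $q(x,k)=\frac{k^2}{4}\bigl(x+1+\frac{2}{x+1}+\frac1{(x+1)^3}\bigr)+\frac{Z_+}{2}\bigl(1+\frac1{(x+1)^2}\bigr)-\frac{\mu}{x+1}$. **Phase function.** For every $j\ge 1$ split $\frac{\mu}{1+\tau^2}-\frac{Z_+}{\sqrt{1+\tau^2}}=s_j(\tau)+l_j(\tau)$ with $s_j\in L^1((0,\infty))$ and $l_j\in C^2((0,\infty))$ real, $|l_j|\le 1/j$, and $l_j(\tau)=-Z_+/\sqrt{1+\tau^2}$ for all large $\tau$. Put $\Omega_j=\{k:|k|^2>1/j\}$ and $\phi_j(\xi,k)=\int_0^{\sinh\xi}\sqrt{k^2-l_j(\tau)}\,d\tau$ for $k\in\Omega_j$, where $\sqrt{k^2-l}:=k\sqrt{1-l/k^2}$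 with the principal root. Let $\phi$ be a global phase function: for every $j\geq 1$ there are an analytic $g_j$ on $\Omega_j$ and an $\widetilde R_j$ with $\phi(\xi,k)=\phi_j(\xi,k)+g_j(k)$ for $\xi>\widetilde R_j$, $k\in\Omega_j$; and $\phi(\xi,-k)=-\phi(\xi,k)$ for all $k\ne0$ and all sufficiently large $\xi$ (depending on $k$). **Solutions.** Let $v_\pm(\xi,k)$ be the solutions with $$v_\pm(\xi,k)=\sqrt2\,e^{-\xi/2}e^{\pm i\phi(\xi,k)}(1+o(1)),\qquad \xi\to\infty,$$ for $k\ne 0$ in the closed upper ($+$), resp. lower ($-$) half-plane, continued analytically in $k$ across the real half-axes: $v_+$ to $-\beta<\arg k<\pi+\alpha$ and $v_-$ to $-\pi-\beta<\arg k<\alpha$, for all $\alpha,\beta\in[0,\pi)$ (domains over $\mathbb C\setminus\{0\}$ that may be two-sheeted; $\arg k\in[0,\pi]$ is the closed upper half-plane for $v_+$, $\arg k\in[-\pi,0]$ the closed lower half-plane for $v_-$). Let $v_0(\xi,k)$ be the solution with $v_0(0,k)=1$, $v_0'(0,k)=0$, and write $\tilde v_{\pm,0}(x,k):=v_{\pm,0}(\log(x+1),k)$.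 With $W(f,g)=(x+1)(fg'-f'g)$ define $$f_\pm(k)=W(\tilde v_\pm,\tilde v_0),\quad e(x,k)=\frac{\tilde v_0(x,k)}{f_+(k)},\quad G(x,x';k)=e(x_<,k)\,\tilde v_+(x_>,k),\quad s(k)=\frac{f_-(k)}{f_+(k)},$$ where $x_<=\min\{x,x'\}$, $x_>=\max\{x,x'\}$. **Claim.** Let $\alpha,\beta\in[0,\pi)$, $k\neq0$, $-\beta<\arg k<\alpha$, with $f_+(k)\ne0$ and $f_+(-k)\neq0$. Here $-k$ is taken with $\arg(-k)=\arg k+\pi$ in $v_+$ and $f_+$ (hence in $e$ and $G$), and with $\arg(-k)=\arg k-\pi$ in $f_-$. Then for all $x,x'>0$: 1. $G(x,x';k)-G(x,x';-k)=2ik\,e(x_<,k)\,e(x_>,-k)$; 2. $s(-k)=s(k)^{-1}$; 3. $s(k)\,e(x,-k)=e(x,k)$. -/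

import Mathlib

noncomputable section

namespace TwoCenter

/-! ### The radial equation -/

/-- `v` solves `v'' + (k² cosh² ξ + Z cosh ξ - μ) v = 0`. The coefficients are entire in `ξ`, so
every solution on the half-line is the restriction of exactly one solution on `ℝ`; solutions are
therefore taken on `ℝ`, which gives meaning to the initial values at `ξ = 0`. -/
structure IsRadialSolution (Z : ℝ) (μ k : ℂ) (v : ℝ → ℂ) : Prop where
  differentiable : Differentiable ℝ v
  equation : ∀ ξ : ℝ, HasDerivAt (deriv v)
    (-(k ^ 2 * (Real.cosh ξ : ℂ) ^ 2 + (Z : ℂ) * (Real.cosh ξ : ℂ) - μ) * v ξ) ξ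

/-! ### The phase function -/

/-- The function `q(τ) = μ / (1 + τ²) - Z / √(1 + τ²)`. -/
def phasePotential (Z : ℝ) (μ : ℂ) (τ : ℝ) : ℂ :=
  μ / ((1 + τ ^ 2 : ℝ) : ℂ) - ((Z / Real.sqrt (1 + τ ^ 2) : ℝ) : ℂ)

/-- `l` is an admissible long-range part of `q` at level `j`: the remainder `q - l` is integrable
on `(0, ∞)`, `l` is `C²` there, `|l| ≤ 1 / j`, and `l` is the Coulomb tail near infinity. -/
structure IsLongRangePart (Z : ℝ) (μ : ℂ) (j : ℕ) (l : ℝ → ℝ) : Prop where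
  shortRange_integrable :
    MeasureTheory.IntegrableOn (fun τ => phasePotential Z μ τ - (l τ : ℂ)) (Set.Ioi 0)
  contDiffOn : ContDiffOn ℝ 2 l (Set.Ioi 0)
  abs_le : ∀ τ : ℝ, 0 < τ → |l τ| ≤ 1 / (j : ℝ)
  tail : ∃ R : ℝ, ∀ τ : ℝ, R < τ → l τ = -(Z / Real.sqrt (1 + τ ^ 2))

/-- The domain `Ω_j = {k : |k|² > 1 / j}`. -/
def phaseDomain (j : ℕ) : Set ℂ := {k : ℂ | 1 / (j : ℝ) < ‖k‖ ^ 2}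

/-- `φ_j(ξ, k) = ∫_0^{sinh ξ} √(k² - l(τ)) dτ`, where on `Ω_j` the root is the branch
`k √(1 - l / k²)`, analytic in `k` and positive for large positive `k`. -/
def localPhase (l : ℝ → ℝ) (ξ : ℝ) (k : ℂ) : ℂ :=
  ∫ τ in (0 : ℝ)..(Real.sinh ξ), k * (1 - (l τ : ℂ) / k ^ 2) ^ (1 / 2 : ℂ)

/-- `φ` is a global phase function: near `ξ = ∞` it differs from each local phase function, on
its domain `Ω_j`, by an analytic function of `k` alone, and it is odd in `k` (as a germ at
`ξ = ∞`). -/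
structure IsGlobalPhase (Z : ℝ) (μ : ℂ) (φ : ℝ → ℂ → ℂ) : Prop where
  local_form : ∃ l : ℕ → ℝ → ℝ, ∀ j : ℕ, 1 ≤ j → IsLongRangePart Z μ j (l j) ∧
    ∃ g : ℂ → ℂ, AnalyticOnNhd ℂ g (phaseDomain j) ∧
      ∃ R : ℝ, ∀ ξ : ℝ, R < ξ → ∀ k ∈ phaseDomain j, φ ξ k = localPhase (l j) ξ k + g k
  odd : ∀ k : ℂ, k ≠ 0 → ∀ᶠ ξ in Filter.atTop, φ ξ (-k) = -φ ξ k

/-! ### Outgoing and incoming solutions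

The spectral parameter lives on a sheeted domain over `ℂ \ {0}`. A point of it is given by its
logarithm `w`, so that `k = exp w` and `arg k = Im w`. The upper half-plane is `0 < Im w < π`, the
lower one (entered through the positive real axis) is `-π < Im w < 0`. -/

/-- The union over `α, β ∈ [0, π)` of the domains `-β < arg k < π + α` of the outgoing
solution. -/
def outgoingDomain : Set ℂ := {w : ℂ | -Real.pi < w.im ∧ w.im < 2 * Real.pi}

/-- The union over `α, β ∈ [0, π)` of the domains `-π - β < arg k < α` of the incoming
solution. -/
def incomingDomain : Set ℂ := {w : ℂ | -(2 * Real.pi) < w.im ∧ w.im < Real.pi}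

/-- `v ξ w` is `v₊(ξ, exp w)`: solutions with
`v₊ = √2 e^{-ξ/2} e^{iφ} (1 + o(1))` for `k` in the closed upper half-plane without `0`, continued
analytically in `k` across the real half-axes. -/
structure IsOutgoingFamily (Z : ℝ) (μ : ℂ) (φ : ℝ → ℂ → ℂ) (v : ℝ → ℂ → ℂ) : Prop where
  solution : ∀ w ∈ outgoingDomain, IsRadialSolution Z μ (Complex.exp w) (fun ξ => v ξ w)
  analytic : ∀ ξ : ℝ, AnalyticOnNhd ℂ (fun w => v ξ w) outgoingDomain
  analytic_deriv : ∀ ξ : ℝ, AnalyticOnNhd ℂ (fun w => deriv (fun t => v t w) ξ) outgoingDomain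
  asymptotics : ∀ w : ℂ, 0 ≤ w.im → w.im ≤ Real.pi →
    Asymptotics.IsEquivalent Filter.atTop (fun ξ => v ξ w)
      (fun ξ => (Real.sqrt 2 : ℂ) * (Real.exp (-ξ / 2) : ℂ) *
        Complex.exp (Complex.I * φ ξ (Complex.exp w)))

/-- `v ξ w` is `v₋(ξ, exp w)`: solutions with
`v₋ = √2 e^{-ξ/2} e^{-iφ} (1 + o(1))` for `k` in the closed lower half-plane without `0`, continued
analytically in `k` across the real half-axes. -/
structure IsIncomingFamily (Z : ℝ) (μ : ℂ) (φ : ℝ → ℂ → ℂ) (v : ℝ → ℂ → ℂ) : Prop where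
  solution : ∀ w ∈ incomingDomain, IsRadialSolution Z μ (Complex.exp w) (fun ξ => v ξ w)
  analytic : ∀ ξ : ℝ, AnalyticOnNhd ℂ (fun w => v ξ w) incomingDomain
  analytic_deriv : ∀ ξ : ℝ, AnalyticOnNhd ℂ (fun w => deriv (fun t => v t w) ξ) incomingDomain
  asymptotics : ∀ w : ℂ, -Real.pi ≤ w.im → w.im ≤ 0 →
    Asymptotics.IsEquivalent Filter.atTop (fun ξ => v ξ w)
      (fun ξ => (Real.sqrt 2 : ℂ) * (Real.exp (-ξ / 2) : ℂ) *
        Complex.exp (-(Complex.I * φ ξ (Complex.exp w))))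

/-- `v₀` solves the radial equation with `v₀(0) = 1`, `v₀'(0) = 0`. -/
structure IsRegularSolution (Z : ℝ) (μ k : ℂ) (v : ℝ → ℂ) : Prop where
  solution : IsRadialSolution Z μ k v
  value_zero : v 0 = 1
  deriv_zero : deriv v 0 = 0

open Classical in
/-- The outgoing solution `v₊`, the (unique) outgoing family for the phase function `φ`. -/
def outgoing (Z : ℝ) (μ : ℂ) (φ : ℝ → ℂ → ℂ) : ℝ → ℂ → ℂ :=
  if h : ∃ v, IsOutgoingFamily Z μ φ v then h.choose else 0

open Classical in
/-- The incoming solution `v₋`, the (unique) incoming family for the phase function `φ`. -/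
def incoming (Z : ℝ) (μ : ℂ) (φ : ℝ → ℂ → ℂ) : ℝ → ℂ → ℂ :=
  if h : ∃ v, IsIncomingFamily Z μ φ v then h.choose else 0

open Classical in
/-- The regular solution `v₀`. -/
def regular (Z : ℝ) (μ k : ℂ) : ℝ → ℂ :=
  if h : ∃ v, IsRegularSolution Z μ k v then h.choose else 0

/-! ### The variable `x = e^ξ - 1` -/

/-- `ṽ₊(x, k) = v₊(log (x + 1), k)`. -/
def outgoingX (Z : ℝ) (μ : ℂ) (φ : ℝ → ℂ → ℂ) (x : ℝ) (w : ℂ) : ℂ :=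
  outgoing Z μ φ (Real.log (x + 1)) w

/-- `ṽ₋(x, k) = v₋(log (x + 1), k)`. -/
def incomingX (Z : ℝ) (μ : ℂ) (φ : ℝ → ℂ → ℂ) (x : ℝ) (w : ℂ) : ℂ :=
  incoming Z μ φ (Real.log (x + 1)) w

/-- `ṽ₀(x, k) = v₀(log (x + 1), k)`. -/
def regularX (Z : ℝ) (μ : ℂ) (x : ℝ) (k : ℂ) : ℂ :=
  regular Z μ k (Real.log (x + 1))

/-- The Wronskian `W_x(f, g) = p(x) (f(x) g'(x) - f'(x) g(x))` with `p(x) = x + 1`. -/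
def wronskian (f g : ℝ → ℂ) (x : ℝ) : ℂ :=
  ((x + 1 : ℝ) : ℂ) * (f x * deriv g x - deriv f x * g x)

/-! ### Jost functions, generalised eigenfunctions, Green's function, scattering element

The Wronskians of two solutions do not depend on `x`; they are evaluated at `x = 0`. -/

/-- The Jost function `f₊ = W(ṽ₊, ṽ₀)` at `k = exp w`. -/
def jostPlus (Z : ℝ) (μ : ℂ) (φ : ℝ → ℂ → ℂ) (w : ℂ) : ℂ :=
  wronskian (fun x => outgoingX Z μ φ x w) (fun x => regularX Z μ x (Complex.exp w)) 0

/-- The Jost function `f₋ = W(ṽ₋, ṽ₀)` at `k = exp w`. -/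
def jostMinus (Z : ℝ) (μ : ℂ) (φ : ℝ → ℂ → ℂ) (w : ℂ) : ℂ :=
  wronskian (fun x => incomingX Z μ φ x w) (fun x => regularX Z μ x (Complex.exp w)) 0

/-- The generalised eigenfunction `e(x, k) = f₊(k)⁻¹ ṽ₀(x, k)` at `k = exp w`. -/
def genEigenfunction (Z : ℝ) (μ : ℂ) (φ : ℝ → ℂ → ℂ) (x : ℝ) (w : ℂ) : ℂ :=
  (jostPlus Z μ φ w)⁻¹ * regularX Z μ x (Complex.exp w)

/-- The radial Green's function `G(x, x'; k) = e(x_<, k) ṽ₊(x_>, k)` at `k = exp w`. -/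
def greenFunction (Z : ℝ) (μ : ℂ) (φ : ℝ → ℂ → ℂ) (x x' : ℝ) (w : ℂ) : ℂ :=
  genEigenfunction Z μ φ (min x x') w * outgoingX Z μ φ (max x x') w

/-- The scattering matrix element `s(k) = f₋(k) / f₊(k)`. Here `p` and `m` are the points over
the same `k` in the domains of `f₊` and of `f₋`, that is `exp p = exp m = k`. -/
def scatteringElement (Z : ℝ) (μ : ℂ) (φ : ℝ → ℂ → ℂ) (p m : ℂ) : ℂ :=
  jostMinus Z μ φ m / jostPlus Z μ φ p

/-! ### The points `k` and `-k`

For `k ≠ 0` off the negative half-axis, `k` lies in both domains, with logarithm `Complex.log k`.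
The point `-k` lies in the domain of the outgoing solution with `arg (-k) = arg k + π` and in the
domain of the incoming solution with `arg (-k) = arg k - π`. -/

/-- The point `k`, with its principal argument. -/
def pt (k : ℂ) : ℂ := Complex.log k

/-- The point `-k` in the domain of the outgoing solution. -/
def negPtOut (k : ℂ) : ℂ := Complex.log k + Real.pi * Complex.I

/-- The point `-k` in the domain of the incoming solution. -/
def negPtIn (k : ℂ) : ℂ := Complex.log k - Real.pi * Complex.I

end TwoCenter

end

/-!
Since `φ` is odd in `k`, `w ↦ v₊(ξ, w + iπ)` has the asymptotics that determine `v₋(ξ, w)`. Both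
`v₋(k) = v₊(-k)` and `W(v₋, v₊) = 2ik` extend by analytic continuation from the half-axis `k > 0`.

There the asymptotics of the solutions alone, without those of their derivatives, determine
Wronskians. If `u` behaves like `√2 e^{-ξ/2} e^{-iφ}`, then in the variable `t = sinh ξ` the
quotient `v / u` has derivative `W(u, v) / (u² cosh ξ) ∼ W(u, v) E`, where `E = e^{2iφ}` oscillates
with frequency `2k`. Hence `v / u = c E + d + o(1)` is only possible with `W(u, v) = 2ikc`. The case
`c = 1`, `d = 0` gives `W(v₋, v₊)`, and `c = 0`, `d = 1` shows that `v₋` is determined by its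
asymptotics.

The three claims then follow from the Plücker relation between the Wronskians of `v₊(k)`,
`v₊(-k)` and `v₀`.
-/

namespace TwoCenter

open Filter Topology Asymptotics

/-! ### Second-order linear equations -/

/-- `u` solves `u'' = q u` on `ℝ`; the radial equation is the case `q = radialCoeff Z μ k`. -/
structure IsSchrodingerSolution (q u : ℝ → ℂ) : Prop where
  differentiable : Differentiable ℝ u
  equation : ∀ ξ : ℝ, HasDerivAt (deriv u) (q ξ * u ξ) ξ

/-- The Wronskian `u v' - u' v` in the variable `ξ`, whereas `wronskian` is taken in the variable
`x = e^ξ - 1`. -/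
noncomputable def radialWronskian (u v : ℝ → ℂ) (ξ : ℝ) : ℂ := u ξ * deriv v ξ - deriv u ξ * v ξ

theorem radialWronskian_plucker (u v r : ℝ → ℂ) (ξ : ℝ) :
    u ξ * radialWronskian v r ξ - v ξ * radialWronskian u r ξ = radialWronskian v u ξ * r ξ := by
  simp only [radialWronskian]
  ring

namespace IsSchrodingerSolution

variable {q u v : ℝ → ℂ}

theorem hasDerivAt (hu : IsSchrodingerSolution q u) (ξ : ℝ) : HasDerivAt u (deriv u ξ) ξ :=
  (hu.differentiable ξ).hasDerivAt

theorem const_mul (hu : IsSchrodingerSolution q u) (c : ℂ) :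
    IsSchrodingerSolution q fun ξ => c * u ξ where
  differentiable := hu.differentiable.const_mul c
  equation ξ := by
    have hderiv : deriv (fun t => c * u t) = fun t => c * deriv u t :=
      funext fun t => ((hu.hasDerivAt t).const_mul c).deriv
    rw [hderiv, mul_left_comm]
    exact (hu.equation ξ).const_mul c

theorem radialWronskian_eq (hu : IsSchrodingerSolution q u) (hv : IsSchrodingerSolution q v)
    (ξ η : ℝ) : radialWronskian u v ξ = radialWronskian u v η := by
  have hderiv : ∀ t, HasDerivAt (radialWronskian u v) 0 t := fun t => by
    refine (((hu.hasDerivAt t).mul (hv.equation t)).sub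
      ((hu.equation t).mul (hv.hasDerivAt t))).congr_deriv ?_
    ring
  exact is_const_of_deriv_eq_zero (fun t => (hderiv t).differentiableAt)
    (fun t => (hderiv t).deriv) ξ η

theorem hasDerivAt_div (hu : IsSchrodingerSolution q u) (hv : IsSchrodingerSolution q v) {ξ : ℝ}
    (hξ : u ξ ≠ 0) :
    HasDerivAt (fun t => v t / u t) (radialWronskian u v ξ / u ξ ^ 2) ξ := by
  refine ((hv.hasDerivAt ξ).div (hu.hasDerivAt ξ) hξ).congr_deriv ?_
  rw [radialWronskian]
  ring

theorem eq_of_initial (hq : Continuous q) (hu : IsSchrodingerSolution q u)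
    (hv : IsSchrodingerSolution q v) {ξ : ℝ} (h_value : u ξ = v ξ)
    (h_deriv : deriv u ξ = deriv v ξ) : u = v := by
  funext η
  obtain ⟨a, ha⟩ := exists_lt (min ξ η)
  obtain ⟨b, hb⟩ := exists_gt (max ξ η)
  rw [lt_min_iff] at ha
  rw [max_lt_iff] at hb
  obtain ⟨M, hM⟩ := (isCompact_Icc (a := a) (b := b)).exists_bound_of_continuousOn hq.continuousOn
  have h_lipschitz : ∀ t ∈ Set.Ioo a b, LipschitzOnWith (max 1 M.toNNReal)
      (fun y : ℂ × ℂ => (y.2, q t * y.1)) Set.univ := fun t ht => by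
    have hqt : ‖q t‖₊ * 1 ≤ M.toNNReal := by
      rw [mul_one, ← norm_toNNReal]
      exact Real.toNNReal_le_toNNReal (hM t ⟨ht.1.le, ht.2.le⟩)
    exact ((LipschitzWith.prod_snd.prodMk ((lipschitzWith_smul (q t)).comp
      LipschitzWith.prod_fst)).weaken (max_le_max le_rfl hqt)).lipschitzOnWith
  exact congrArg Prod.fst (ODE_solution_unique_of_mem_Ioo
    (f := fun t => (u t, deriv u t)) (g := fun t => (v t, deriv v t)) h_lipschitz ⟨ha.1, hb.1⟩
    (fun t _ => ⟨(hu.hasDerivAt t).prodMk (hu.equation t), trivial⟩)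
    (fun t _ => ⟨(hv.hasDerivAt t).prodMk (hv.equation t), trivial⟩)
    (Prod.ext h_value h_deriv) ⟨ha.2, hb.2⟩)

theorem eq_const_mul_of_radialWronskian_eq_zero (hq : Continuous q)
    (hu : IsSchrodingerSolution q u) (hv : IsSchrodingerSolution q v) {ξ : ℝ} (hξ : u ξ ≠ 0)
    (hW : radialWronskian u v ξ = 0) : v = fun η => v ξ / u ξ * u η := by
  refine hv.eq_of_initial hq (hu.const_mul (v ξ / u ξ)) (ξ := ξ) (div_mul_cancel₀ _ hξ).symm ?_
  rw [((hu.hasDerivAt ξ).const_mul _).deriv, div_mul_eq_mul_div, eq_div_iff hξ]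
  rw [radialWronskian] at hW
  linear_combination hW

end IsSchrodingerSolution

/-! ### Slowly varying and oscillating functions -/

theorem tendsto_add_sub_of_deriv_tendsto_zero {F : Type*} [NormedAddCommGroup F]
    [NormedSpace ℝ F] {f f' : ℝ → F} (hf : ∀ᶠ t in atTop, HasDerivAt f (f' t) t)
    (hf' : Tendsto f' atTop (𝓝 0)) (s : ℝ) :
    Tendsto (fun t => f (t + s) - f t) atTop (𝓝 0) := by
  rw [Metric.tendsto_nhds]
  intro ε hε
  have hδ : 0 < ε / (|s| + 1) := by positivity
  have h_small : ∀ᶠ t in atTop, ‖f' t‖ < ε / (|s| + 1) := by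
    simpa only [dist_zero_right] using Metric.tendsto_nhds.1 hf' _ hδ
  obtain ⟨R, hR⟩ := eventually_atTop.1 (hf.and h_small)
  filter_upwards [eventually_ge_atTop R, eventually_ge_atTop (R - s)] with t ht hts
  have h_mean := (convex_Ici R).norm_image_sub_le_of_norm_hasDerivWithin_le
    (fun τ hτ => (hR τ hτ).1.hasDerivWithinAt) (fun τ hτ => (hR τ hτ).2.le) (x := t) (y := t + s)
    ht (Set.mem_Ici.2 (by linarith))
  rw [add_sub_cancel_left, Real.norm_eq_abs] at h_mean
  calc dist (f (t + s) - f t) 0 = ‖f (t + s) - f t‖ := dist_zero_right _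
    _ ≤ ε / (|s| + 1) * |s| := h_mean
    _ < ε / (|s| + 1) * (|s| + 1) := mul_lt_mul_of_pos_left (lt_add_one _) hδ
    _ = ε := div_mul_cancel₀ _ (by positivity)

theorem tendsto_add_sub_exp_mul {y y' : ℝ → ℂ} {ω : ℝ}
    (hy : ∀ᶠ t in atTop, HasDerivAt y (y' t) t)
    (hy' : Tendsto (fun t => y' t - ω * Complex.I * y t) atTop (𝓝 0)) (s : ℝ) :
    Tendsto (fun t => y (t + s) - Complex.exp ((ω * s : ℝ) * Complex.I) * y t) atTop (𝓝 0) := by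
  set r : ℝ → ℂ := fun t => Complex.exp ((-(ω * t) : ℝ) * Complex.I) with hr
  have hr_norm : ∀ t, ‖r t‖ = 1 := fun t => Complex.norm_exp_ofReal_mul_I _
  have hr_deriv : ∀ t, HasDerivAt r (r t * (-ω * Complex.I)) t := fun t => by
    have h_lin : HasDerivAt (fun t : ℝ => -(ω * t)) (-ω) t := by
      simpa using ((hasDerivAt_id t).const_mul ω).fun_neg
    refine (h_lin.ofReal_comp.mul_const Complex.I).cexp.congr_deriv ?_
    simp only [hr, Complex.ofReal_neg]
  have h_slow := tendsto_add_sub_of_deriv_tendsto_zero (f := fun t => y t * r t)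
    (f' := fun t => (y' t - ω * Complex.I * y t) * r t)
    (hy.mono fun t ht => (ht.mul (hr_deriv t)).congr_deriv (by ring))
    (by
      rw [tendsto_zero_iff_norm_tendsto_zero] at hy' ⊢
      simpa only [norm_mul, hr_norm, mul_one] using hy') s
  rw [tendsto_zero_iff_norm_tendsto_zero] at h_slow ⊢
  refine h_slow.congr fun t => ?_
  have hr_add : r t = Complex.exp ((ω * s : ℝ) * Complex.I) * r (t + s) := by
    simp only [hr, ← Complex.exp_add]
    push_cast
    ring_nf
  rw [← mul_one ‖y (t + s) - _‖, ← hr_norm (t + s), ← norm_mul, hr_add]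
  ring_nf

/-- `h - (W / iω) E` varies slowly, whereas `E` changes sign over half a period `π / ω`. -/
theorem eq_mul_of_oscillation {ω : ℝ} (hω : ω ≠ 0) {E E' h h' : ℝ → ℂ} {W c d : ℂ}
    (hE : ∀ᶠ t in atTop, HasDerivAt E (E' t) t)
    (hE' : Tendsto (fun t => E' t - ω * Complex.I * E t) atTop (𝓝 0))
    (hE_zero : ¬Tendsto E atTop (𝓝 0))
    (hh : ∀ᶠ t in atTop, HasDerivAt h (h' t) t)
    (hhE : Tendsto (fun t => h t - (c * E t + d)) atTop (𝓝 0))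
    (hh' : Tendsto (fun t => h' t - W * E t) atTop (𝓝 0)) : W = ω * Complex.I * c := by
  have hωI : ω * Complex.I ≠ 0 := mul_ne_zero (Complex.ofReal_ne_zero.2 hω) Complex.I_ne_zero
  obtain ⟨a, rfl⟩ : ∃ a, W = ω * Complex.I * a := ⟨_, (mul_div_cancel₀ W hωI).symm⟩
  set s : ℝ := Real.pi / ω
  have h_slow : Tendsto (fun t => (h (t + s) - a * E (t + s)) - (h t - a * E t)) atTop (𝓝 0) := by
    refine tendsto_add_sub_of_deriv_tendsto_zero (f' := fun t => h' t - a * E' t)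
      ((hh.and hE).mono fun t ht => ht.1.sub (ht.2.const_mul a)) ?_ s
    have h_lim := hh'.sub (hE'.const_mul a)
    rw [mul_zero, sub_zero] at h_lim
    exact h_lim.congr fun t => by ring
  have h_shift : Tendsto (fun t => h (t + s) - (c * E (t + s) + d)) atTop (𝓝 0) :=
    hhE.comp (tendsto_atTop_add_const_right _ s tendsto_id)
  have h_diff : Tendsto (fun t => (c - a) * (E (t + s) - E t)) atTop (𝓝 0) := by
    have h_lim := (h_slow.sub h_shift).add hhE
    rw [sub_zero, add_zero] at h_lim
    exact h_lim.congr fun t => by ring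
  have h_sum : Tendsto (fun t => E (t + s) + E t) atTop (𝓝 0) := by
    refine (tendsto_add_sub_exp_mul hE hE' s).congr fun t => ?_
    rw [mul_div_cancel₀ _ hω, Complex.exp_pi_mul_I]
    ring
  have h_limE : Tendsto (fun t => (c - a) * E t) atTop (𝓝 0) := by
    have h_lim := ((h_sum.const_mul (c - a)).sub h_diff).div_const 2
    rw [mul_zero, sub_zero, zero_div] at h_lim
    exact h_lim.congr fun t => by ring
  by_contra hne
  have hca : c - a ≠ 0 := sub_ne_zero.2 fun hca => hne (by rw [hca])
  refine hE_zero ?_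
  have h_lim := h_limE.const_mul (c - a)⁻¹
  rw [mul_zero] at h_lim
  exact h_lim.congr fun t => inv_mul_cancel_left₀ hca _

/-! ### Wronskians from asymptotics -/

/-- The amplitude `√2 e^{-ξ/2}` common to the asymptotics of `v₊` and `v₋`. -/
noncomputable def waveAmplitude (ξ : ℝ) : ℂ := (Real.sqrt 2 : ℂ) * (Real.exp (-ξ / 2) : ℂ)

theorem waveAmplitude_ne_zero (ξ : ℝ) : waveAmplitude ξ ≠ 0 :=
  mul_ne_zero (Complex.ofReal_ne_zero.2 (by positivity))
    (Complex.ofReal_ne_zero.2 (Real.exp_pos _).ne')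

theorem tendsto_waveAmplitude_sq_mul_cosh :
    Tendsto (fun ξ => waveAmplitude ξ ^ 2 * (Real.cosh ξ : ℂ)) atTop (𝓝 1) := by
  have h_eq : ∀ ξ : ℝ, waveAmplitude ξ ^ 2 * (Real.cosh ξ : ℂ)
      = ((1 + Real.exp (-(2 * ξ)) : ℝ) : ℂ) := fun ξ => by
    rw [waveAmplitude, ← Complex.ofReal_mul, ← Complex.ofReal_pow, ← Complex.ofReal_mul, mul_pow,
      Real.sq_sqrt zero_le_two, ← Real.exp_nat_mul, Real.cosh_eq]
    congr 1
    rw [show ((2 : ℕ) : ℝ) * (-ξ / 2) = -ξ by push_cast; ring,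
      show -(2 * ξ) = -ξ + -ξ by ring, Real.exp_add, Real.exp_neg]
    field_simp
  have h_lim : Tendsto (fun ξ : ℝ => 1 + Real.exp (-(2 * ξ))) atTop (𝓝 1) := by
    simpa using (Real.tendsto_exp_neg_atTop_nhds_zero.comp
      (tendsto_id.const_mul_atTop (zero_lt_two' ℝ))).const_add 1
  simpa only [h_eq, Complex.ofReal_one, Function.comp_def] using
    (Complex.continuous_ofReal.tendsto 1).comp h_lim

theorem tendsto_arsinh_atTop : Tendsto Real.arsinh atTop atTop :=
  Real.sinhOrderIso.symm.tendsto_atTop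

theorem norm_exp_two_mul_I_mul (z : ℂ) :
    ‖Complex.exp (2 * Complex.I * z)‖ = Real.exp (-(2 * z.im)) := by
  rw [Complex.norm_exp]
  simp

/-- `e^{iψ}` is asymptotically a plane wave with real wave number `κ` in the variable
`t = sinh ξ`. -/
structure HasWavenumber (ψ : ℝ → ℂ) (κ : ℝ) : Prop where
  bounded_im : ∃ m : ℝ, ∀ᶠ ξ in atTop, |(ψ ξ).im| ≤ m
  tendsto_deriv : ∃ p : ℝ → ℂ,
    (∀ᶠ t in atTop, HasDerivAt (fun t => ψ (Real.arsinh t)) (p t) t) ∧ Tendsto p atTop (𝓝 κ)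

namespace HasWavenumber

variable {ψ : ℝ → ℂ} {κ : ℝ}

theorem isBigO_exp (hψ : HasWavenumber ψ κ) :
    (fun ξ => Complex.exp (2 * Complex.I * ψ ξ)) =O[atTop] fun _ => (1 : ℂ) := by
  obtain ⟨m, hm⟩ := hψ.bounded_im
  refine IsBigO.of_bound (Real.exp (2 * m)) (hm.mono fun ξ hξ => ?_)
  rw [norm_exp_two_mul_I_mul, norm_one, mul_one, Real.exp_le_exp]
  linarith [(abs_le.1 hξ).1]

theorem not_tendsto_exp_zero (hψ : HasWavenumber ψ κ) :
    ¬Tendsto (fun ξ => Complex.exp (2 * Complex.I * ψ ξ)) atTop (𝓝 0) := fun h_lim => by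
  obtain ⟨m, hm⟩ := hψ.bounded_im
  refine (Real.exp_pos (-(2 * m))).not_ge
    (ge_of_tendsto (tendsto_zero_iff_norm_tendsto_zero.1 h_lim) (hm.mono fun ξ hξ => ?_))
  rw [norm_exp_two_mul_I_mul, Real.exp_le_exp]
  linarith [(abs_le.1 hξ).2]

theorem exists_hasDerivAt_exp (hψ : HasWavenumber ψ κ) :
    ∃ E' : ℝ → ℂ,
      (∀ᶠ t in atTop,
        HasDerivAt (fun t => Complex.exp (2 * Complex.I * ψ (Real.arsinh t))) (E' t) t) ∧
      Tendsto (fun t => E' t - (2 * κ : ℝ) * Complex.I *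
        Complex.exp (2 * Complex.I * ψ (Real.arsinh t))) atTop (𝓝 0) := by
  obtain ⟨p, hp, hp_lim⟩ := hψ.tendsto_deriv
  refine ⟨_, hp.mono fun t ht => (ht.const_mul (2 * Complex.I)).cexp, ?_⟩
  have h_small : (fun t => 2 * Complex.I * (p t - κ)) =o[atTop] fun _ => (1 : ℂ) := by
    rw [isLittleO_one_iff]
    simpa using (hp_lim.sub_const (κ : ℂ)).const_mul (2 * Complex.I)
  have h_mul : (fun t => 2 * Complex.I * (p t - κ) *
      Complex.exp (2 * Complex.I * ψ (Real.arsinh t))) =o[atTop] fun _ => (1 : ℂ) := by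
    simpa only [mul_one, Function.comp_def] using
      h_small.mul_isBigO (hψ.isBigO_exp.comp_tendsto tendsto_arsinh_atTop)
  exact ((isLittleO_one_iff ℂ).1 h_mul).congr fun t => by push_cast; ring

end HasWavenumber

theorem isEquivalent_inv_sq_mul_cosh {u ψ : ℝ → ℂ}
    (hu : u ~[atTop] fun ξ => waveAmplitude ξ * Complex.exp (-(Complex.I * ψ ξ))) :
    (fun ξ => (u ξ ^ 2 * (Real.cosh ξ : ℂ))⁻¹) ~[atTop]
      fun ξ => Complex.exp (2 * Complex.I * ψ ξ) := by
  have h_amp := (isEquivalent_const_iff_tendsto one_ne_zero).2 tendsto_waveAmplitude_sq_mul_cosh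
  have h_sq := ((hu.pow 2).mul (IsEquivalent.refl (u := fun ξ => (Real.cosh ξ : ℂ)))).inv
  have h_wave := h_amp.inv.mul
    (IsEquivalent.refl (u := fun ξ => Complex.exp (2 * Complex.I * ψ ξ)))
  refine (h_sq.congr_right (Eventually.of_forall fun ξ => ?_)).trans
    (h_wave.congr_right (Eventually.of_forall fun ξ => ?_))
  · simp only [Pi.inv_apply, Pi.mul_apply, Pi.pow_apply, mul_pow, mul_inv, ← Complex.exp_nat_mul,
      ← Complex.exp_neg]
    push_cast
    ring_nf
  · simp

namespace IsSchrodingerSolution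

variable {q u v ψ : ℝ → ℂ} {κ : ℝ}

theorem radialWronskian_eq_of_tendsto_div (hκ : κ ≠ 0) (hψ : HasWavenumber ψ κ)
    (hu : IsSchrodingerSolution q u) (hv : IsSchrodingerSolution q v)
    (hu_asymp : u ~[atTop] fun ξ => waveAmplitude ξ * Complex.exp (-(Complex.I * ψ ξ))) {c d : ℂ}
    (h_div : Tendsto (fun ξ => v ξ / u ξ - (c * Complex.exp (2 * Complex.I * ψ ξ) + d))
      atTop (𝓝 0)) (ξ : ℝ) :
    radialWronskian u v ξ = 2 * Complex.I * κ * c := by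
  obtain ⟨E', hE, hE'⟩ := hψ.exists_hasDerivAt_exp
  have hu_ne : ∀ᶠ η in atTop, u η ≠ 0 := by
    have h_inv := isEquivalent_inv_sq_mul_cosh hu_asymp
    filter_upwards [h_inv.isBigO_symm.eq_zero_imp] with η hη hη_zero
    exact Complex.exp_ne_zero _ (hη (by simp [hη_zero]))
  set W := radialWronskian u v ξ
  have h_deriv : ∀ᶠ t in atTop, HasDerivAt (fun t => v (Real.arsinh t) / u (Real.arsinh t))
      (W * (u (Real.arsinh t) ^ 2 * (Real.cosh (Real.arsinh t) : ℂ))⁻¹) t := by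
    filter_upwards [tendsto_arsinh_atTop.eventually hu_ne] with t ht
    refine ((hu.hasDerivAt_div hv ht).scomp t (Real.hasDerivAt_arsinh t)).congr_deriv ?_
    rw [Complex.real_smul, Real.cosh_arsinh, hu.radialWronskian_eq hv _ ξ, mul_inv,
      Complex.ofReal_inv]
    ring
  have h_deriv_lim : Tendsto (fun η => W * (u η ^ 2 * (Real.cosh η : ℂ))⁻¹ -
      W * Complex.exp (2 * Complex.I * ψ η)) atTop (𝓝 0) := by
    have h_sub := (isLittleO_one_iff ℂ).1
      ((isEquivalent_inv_sq_mul_cosh hu_asymp).isLittleO.trans_isBigO hψ.isBigO_exp)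
    simpa only [Pi.sub_apply, mul_sub, mul_zero] using h_sub.const_mul W
  have h_slope := eq_mul_of_oscillation (mul_ne_zero two_ne_zero hκ) hE hE'
    (fun h_lim => hψ.not_tendsto_exp_zero ?_) h_deriv (h_div.comp tendsto_arsinh_atTop)
    (h_deriv_lim.comp tendsto_arsinh_atTop)
  · rw [h_slope]
    push_cast
    ring
  · simpa [Function.comp_def] using h_lim.comp Real.sinhOrderIso.tendsto_atTop

theorem radialWronskian_of_opposite_waves (hκ : κ ≠ 0) (hψ : HasWavenumber ψ κ)
    (hu : IsSchrodingerSolution q u) (hv : IsSchrodingerSolution q v)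
    (hu_asymp : u ~[atTop] fun ξ => waveAmplitude ξ * Complex.exp (-(Complex.I * ψ ξ)))
    (hv_asymp : v ~[atTop] fun ξ => waveAmplitude ξ * Complex.exp (Complex.I * ψ ξ)) (ξ : ℝ) :
    radialWronskian u v ξ = 2 * Complex.I * κ := by
  have h_div : (fun ξ => v ξ / u ξ) ~[atTop] fun ξ => Complex.exp (2 * Complex.I * ψ ξ) := by
    refine (hv_asymp.div hu_asymp).congr_right (Eventually.of_forall fun ξ => ?_)
    rw [Pi.div_apply, mul_div_mul_left _ _ (waveAmplitude_ne_zero ξ), ← Complex.exp_sub]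
    ring_nf
  have h_sub : Tendsto (fun ξ => v ξ / u ξ - Complex.exp (2 * Complex.I * ψ ξ)) atTop (𝓝 0) :=
    (isLittleO_one_iff ℂ).1 (h_div.isLittleO.trans_isBigO hψ.isBigO_exp)
  rw [hu.radialWronskian_eq_of_tendsto_div hκ hψ hv hu_asymp (c := 1) (d := 0) ?_, mul_one]
  simpa only [one_mul, add_zero] using h_sub

theorem eq_of_isEquivalent_wave (hq : Continuous q) (hκ : κ ≠ 0) (hψ : HasWavenumber ψ κ)
    (hu : IsSchrodingerSolution q u) (hv : IsSchrodingerSolution q v)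
    (hu_asymp : u ~[atTop] fun ξ => waveAmplitude ξ * Complex.exp (-(Complex.I * ψ ξ)))
    (hv_asymp : v ~[atTop] fun ξ => waveAmplitude ξ * Complex.exp (-(Complex.I * ψ ξ))) :
    u = v := by
  have hv_ne : ∀ᶠ ξ in atTop, v ξ ≠ 0 := by
    filter_upwards [hv_asymp.isBigO_symm.eq_zero_imp] with ξ hξ hξ_zero
    exact mul_ne_zero (waveAmplitude_ne_zero ξ) (Complex.exp_ne_zero _) (hξ hξ_zero)
  have h_div : Tendsto (fun ξ => u ξ / v ξ) atTop (𝓝 1) :=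
    (isEquivalent_iff_tendsto_one hv_ne).1 (hu_asymp.trans hv_asymp.symm)
  obtain ⟨ξ, hξ⟩ := hv_ne.exists
  have hW : radialWronskian v u ξ = 0 := by
    rw [hv.radialWronskian_eq_of_tendsto_div hκ hψ hu hv_asymp (c := 0) (d := 1) ?_, mul_zero]
    simpa only [zero_mul, zero_add, sub_self] using h_div.sub_const 1
  have h_prop := hv.eq_const_mul_of_radialWronskian_eq_zero hq hu hξ hW
  have h_ratio : u ξ / v ξ = 1 := by
    refine tendsto_nhds_unique (tendsto_const_nhds.congr' ?_) h_div
    filter_upwards [hv_ne] with η hη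
    rw [eq_div_iff hη, ← congrFun h_prop η]
  simpa only [h_ratio, one_mul] using h_prop

end IsSchrodingerSolution

/-! ### The phase function on the positive half-axis -/

theorem localPhase_ofReal {l : ℝ → ℝ} {κ ξ : ℝ} (hκ : 0 < κ) (hl : ∀ τ, 0 < τ → l τ ≤ κ ^ 2)
    (hξ : 0 ≤ ξ) :
    localPhase l ξ κ = ((∫ τ in (0 : ℝ)..(Real.sinh ξ), √(κ ^ 2 - l τ) : ℝ) : ℂ) := by
  rw [localPhase, ← intervalIntegral.integral_ofReal]
  refine intervalIntegral.integral_congr_ae (Eventually.of_forall fun τ hτ => ?_)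
  rw [Set.uIoc_of_le (Real.sinh_nonneg_iff.2 hξ)] at hτ
  have h_nonneg : 0 ≤ 1 - l τ / κ ^ 2 :=
    sub_nonneg.2 (div_le_one_of_le₀ (hl τ hτ.1) (sq_nonneg κ))
  have h_cast : (1 : ℂ) - (l τ : ℂ) / (κ : ℂ) ^ 2 = ((1 - l τ / κ ^ 2 : ℝ) : ℂ) := by push_cast; rfl
  have h_half : (1 / 2 : ℂ) = ((1 / 2 : ℝ) : ℂ) := by push_cast; rfl
  have h_factor : κ ^ 2 - l τ = κ ^ 2 * (1 - l τ / κ ^ 2) := by field_simp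
  rw [h_cast, h_half, ← Complex.ofReal_cpow h_nonneg, ← Real.sqrt_eq_rpow, h_factor,
    Real.sqrt_mul (sq_nonneg κ), Real.sqrt_sq hκ.le, Complex.ofReal_mul]

theorem hasDerivAt_integral_of_continuousOn_Ioi {F : Type*} [NormedAddCommGroup F]
    [NormedSpace ℝ F] [CompleteSpace F] {f : ℝ → F} {a C t : ℝ} (hf : ContinuousOn f (Set.Ioi a))
    (hC : ∀ τ, a < τ → ‖f τ‖ ≤ C) (ht : a < t) :
    HasDerivAt (fun t => ∫ τ in a..t, f τ) (f t) t := by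
  refine intervalIntegral.integral_hasDerivAt_right ?_
    (hf.stronglyMeasurableAtFilter isOpen_Ioi t ht) (hf.continuousAt (Ioi_mem_nhds ht))
  rw [intervalIntegrable_iff_integrableOn_Ioc_of_le ht.le]
  exact MeasureTheory.IntegrableOn.of_bound (C := C) (by simp)
    ((hf.mono fun τ hτ => hτ.1).aestronglyMeasurable measurableSet_Ioc)
    (MeasureTheory.ae_restrict_of_forall_mem measurableSet_Ioc fun τ hτ => hC τ hτ.1)

section Phase

variable {Z : ℝ} {μ : ℂ} {φ : ℝ → ℂ → ℂ}

theorem IsLongRangePart.tendsto_zero {j : ℕ} {l : ℝ → ℝ} (hl : IsLongRangePart Z μ j l) :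
    Tendsto l atTop (𝓝 0) := by
  obtain ⟨R, hR⟩ := hl.tail
  have h_sqrt : Tendsto (fun τ : ℝ => √(1 + τ ^ 2)) atTop atTop :=
    tendsto_atTop_mono (fun τ => Real.le_sqrt_of_sq_le (by simp)) tendsto_id
  have h_tail : Tendsto (fun τ : ℝ => -(Z / √(1 + τ ^ 2))) atTop (𝓝 0) := by
    simpa only [neg_zero] using (h_sqrt.const_div_atTop Z).neg
  exact h_tail.congr' ((eventually_gt_atTop R).mono fun τ hτ => (hR τ hτ).symm)

theorem IsLongRangePart.hasDerivAt_integral_sqrt {j : ℕ} {l : ℝ → ℝ}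
    (hl : IsLongRangePart Z μ j l) (κ : ℝ) {t : ℝ} (ht : 0 < t) :
    HasDerivAt (fun t => ∫ τ in (0 : ℝ)..t, √(κ ^ 2 - l τ)) √(κ ^ 2 - l t) t := by
  refine hasDerivAt_integral_of_continuousOn_Ioi (C := √(κ ^ 2 + 1 / j))
    (f := fun τ => √(κ ^ 2 - l τ))
    (Real.continuous_sqrt.comp_continuousOn (continuousOn_const.sub hl.contDiffOn.continuousOn))
    (fun τ hτ => ?_) ht
  rw [Real.norm_of_nonneg (Real.sqrt_nonneg _)]
  exact Real.sqrt_le_sqrt (by linarith [neg_le_of_abs_le (hl.abs_le τ hτ)])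

theorem IsGlobalPhase.exists_eq_integral (hφ : IsGlobalPhase Z μ φ) {κ : ℝ} (hκ : 0 < κ) :
    ∃ (j : ℕ) (l : ℝ → ℝ) (g : ℂ), IsLongRangePart Z μ j l ∧
      ∀ᶠ ξ in atTop, φ ξ κ = ((∫ τ in (0 : ℝ)..(Real.sinh ξ), √(κ ^ 2 - l τ) : ℝ) : ℂ) + g := by
  obtain ⟨n, hn⟩ := exists_nat_one_div_lt (pow_pos hκ 2)
  obtain ⟨l, hl⟩ := hφ.local_form
  obtain ⟨hL, g, -, R, hg⟩ := hl (n + 1) (Nat.le_add_left 1 n)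
  have hnκ : 1 / ((n + 1 : ℕ) : ℝ) < κ ^ 2 := by exact_mod_cast hn
  refine ⟨n + 1, l (n + 1), g κ, hL, ?_⟩
  filter_upwards [eventually_gt_atTop R, eventually_ge_atTop 0] with ξ hR h_nonneg
  have h_mem : (κ : ℂ) ∈ phaseDomain (n + 1) := by
    simpa only [phaseDomain, Set.mem_ofPred_eq, Complex.norm_real, Real.norm_eq_abs, sq_abs]
      using hnκ
  rw [hg ξ hR κ h_mem, localPhase_ofReal hκ
    (fun τ hτ => (le_abs_self _).trans ((hL.abs_le τ hτ).trans hnκ.le)) h_nonneg]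

theorem IsGlobalPhase.hasWavenumber (hφ : IsGlobalPhase Z μ φ) {κ : ℝ} (hκ : 0 < κ) :
    HasWavenumber (fun ξ => φ ξ κ) κ := by
  obtain ⟨j, l, g, hl, h_eq⟩ := hφ.exists_eq_integral hκ
  refine ⟨⟨|g.im|, h_eq.mono fun ξ hξ => ?_⟩, fun t => (√(κ ^ 2 - l t) : ℝ), ?_, ?_⟩
  · rw [hξ, Complex.add_im, Complex.ofReal_im, zero_add]
  · obtain ⟨T, hT⟩ := eventually_atTop.1 (tendsto_arsinh_atTop.eventually h_eq)
    filter_upwards [eventually_gt_atTop T, eventually_gt_atTop 0] with t htT ht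
    refine ((hl.hasDerivAt_integral_sqrt κ ht).ofReal_comp.add_const g).congr_of_eventuallyEq ?_
    filter_upwards [eventually_gt_nhds htT] with s hs
    rw [hT s hs.le, Real.sinh_arsinh]
  · have h_lim : Tendsto (fun t => √(κ ^ 2 - l t)) atTop (𝓝 κ) := by
      have h_sqrt := (hl.tendsto_zero.const_sub (κ ^ 2)).sqrt
      rwa [sub_zero, Real.sqrt_sq hκ.le] at h_sqrt
    exact (Complex.continuous_ofReal.tendsto κ).comp h_lim

end Phase

/-! ### Analytic continuation in a strip -/

theorem frequently_im_eq (z : ℂ) : ∃ᶠ w in 𝓝[≠] z, w.im = z.im := by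
  have h_line : Tendsto (fun t : ℝ => z + t) (𝓝[≠] 0) (𝓝[≠] z) := by
    refine tendsto_nhdsWithin_of_tendsto_nhds_of_eventually_within _ ?_ ?_
    · exact (Continuous.tendsto' (by fun_prop) 0 z (by simp)).mono_left nhdsWithin_le_nhds
    · filter_upwards [self_mem_nhdsWithin] with t ht
      simpa using ht
  exact h_line.frequently (Frequently.of_forall fun t => by simp)

theorem eqOn_strip_of_eq_on_line {f g : ℂ → ℂ} {a b c : ℝ} (ha : a < c) (hb : c < b)
    (hf : AnalyticOnNhd ℂ f {w | a < w.im ∧ w.im < b})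
    (hg : AnalyticOnNhd ℂ g {w | a < w.im ∧ w.im < b})
    (h_line : ∀ w : ℂ, w.im = c → f w = g w) : Set.EqOn f g {w | a < w.im ∧ w.im < b} :=
  hf.eqOn_of_preconnected_of_frequently_eq hg
    ((convex_halfSpace_im_gt a).inter (convex_halfSpace_im_lt b)).isPreconnected
    (z₀ := c * Complex.I) (by simp [ha, hb])
    ((frequently_im_eq _).mono fun w hw => h_line w (by simpa using hw))

theorem exp_of_im_eq_zero {w : ℂ} (hw : w.im = 0) : Complex.exp w = (Real.exp w.re : ℝ) := by
  have h_re : w = (w.re : ℂ) := Complex.ext rfl (by rw [hw, Complex.ofReal_im])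
  rw [Complex.ofReal_exp, ← h_re]

/-! ### Radial solutions -/

/-- The coefficient `q` for which the radial equation reads `v'' = q v`. -/
noncomputable def radialCoeff (Z : ℝ) (μ k : ℂ) (ξ : ℝ) : ℂ :=
  -(k ^ 2 * (Real.cosh ξ : ℂ) ^ 2 + (Z : ℂ) * (Real.cosh ξ : ℂ) - μ)

theorem continuous_radialCoeff (Z : ℝ) (μ k : ℂ) : Continuous (radialCoeff Z μ k) := by
  unfold radialCoeff
  fun_prop

theorem IsRadialSolution.isSchrodingerSolution {Z : ℝ} {μ k : ℂ} {v : ℝ → ℂ}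
    (hv : IsRadialSolution Z μ k v) : IsSchrodingerSolution (radialCoeff Z μ k) v :=
  ⟨hv.differentiable, hv.equation⟩

theorem isRadialSolution_neg_iff {Z : ℝ} {μ k : ℂ} {v : ℝ → ℂ} :
    IsRadialSolution Z μ (-k) v ↔ IsRadialSolution Z μ k v :=
  ⟨fun h => ⟨h.differentiable, by simpa only [neg_sq] using h.equation⟩,
    fun h => ⟨h.differentiable, by simpa only [neg_sq] using h.equation⟩⟩

theorem isRegularSolution_neg_iff {Z : ℝ} {μ k : ℂ} {v : ℝ → ℂ} :
    IsRegularSolution Z μ (-k) v ↔ IsRegularSolution Z μ k v :=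
  ⟨fun h => ⟨isRadialSolution_neg_iff.1 h.solution, h.value_zero, h.deriv_zero⟩,
    fun h => ⟨isRadialSolution_neg_iff.2 h.solution, h.value_zero, h.deriv_zero⟩⟩

theorem regular_neg (Z : ℝ) (μ k : ℂ) : regular Z μ (-k) = regular Z μ k := by
  have h_pred : IsRegularSolution Z μ (-k) = IsRegularSolution Z μ k :=
    funext fun _ => propext isRegularSolution_neg_iff
  unfold regular
  rw [h_pred]

theorem regularX_neg (Z : ℝ) (μ : ℂ) (x : ℝ) (k : ℂ) :
    regularX Z μ x (-k) = regularX Z μ x k := by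
  rw [regularX, regular_neg, regularX]

/-! ### Outgoing and incoming families -/

theorem exp_add_pi_mul_I (w : ℂ) : Complex.exp (w + Real.pi * Complex.I) = -Complex.exp w := by
  rw [Complex.exp_add, Complex.exp_pi_mul_I, mul_neg_one]

theorem im_add_pi_mul_I (w : ℂ) : (w + Real.pi * Complex.I).im = w.im + Real.pi := by simp

theorem add_pi_mul_I_mem_outgoingDomain {w : ℂ} (hw : w ∈ incomingDomain) :
    w + Real.pi * Complex.I ∈ outgoingDomain := by
  obtain ⟨h_lower, h_upper⟩ := hw
  constructor <;> rw [im_add_pi_mul_I] <;> linarith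

theorem analyticOnNhd_add_pi_mul_I {f : ℂ → ℂ} (hf : AnalyticOnNhd ℂ f outgoingDomain) :
    AnalyticOnNhd ℂ (fun w => f (w + Real.pi * Complex.I)) incomingDomain := fun w hw =>
  (hf _ (add_pi_mul_I_mem_outgoingDomain hw)).fun_comp
    (f := fun w : ℂ => w + Real.pi * Complex.I) (by fun_prop)

/-- The strip `-π < arg k < π`, on which both `v₊` and `v₋` are defined. -/
def commonDomain : Set ℂ := {w : ℂ | -Real.pi < w.im ∧ w.im < Real.pi}

theorem commonDomain_subset_outgoingDomain : commonDomain ⊆ outgoingDomain :=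
  fun _ hw => ⟨hw.1, by linarith [hw.2, Real.pi_pos]⟩

theorem commonDomain_subset_incomingDomain : commonDomain ⊆ incomingDomain :=
  fun _ hw => ⟨by linarith [hw.1, Real.pi_pos], hw.2⟩

theorem mem_commonDomain_of_im_eq_zero {w : ℂ} (hw : w.im = 0) : w ∈ commonDomain := by
  simp only [commonDomain, Set.mem_ofPred_eq, hw, Left.neg_neg_iff, Real.pi_pos, and_self]

section Families

variable {Z : ℝ} {μ : ℂ} {φ : ℝ → ℂ → ℂ} {v v' : ℝ → ℂ → ℂ}

theorem IsOutgoingFamily.isIncomingFamily (hφ : IsGlobalPhase Z μ φ)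
    (hv : IsOutgoingFamily Z μ φ v) :
    IsIncomingFamily Z μ φ (fun ξ w => v ξ (w + Real.pi * Complex.I)) where
  solution w hw := by
    have h_sol := hv.solution _ (add_pi_mul_I_mem_outgoingDomain hw)
    rwa [exp_add_pi_mul_I, isRadialSolution_neg_iff] at h_sol
  analytic ξ := analyticOnNhd_add_pi_mul_I (hv.analytic ξ)
  analytic_deriv ξ := analyticOnNhd_add_pi_mul_I (hv.analytic_deriv ξ)
  asymptotics w h_lower h_upper := by
    refine (hv.asymptotics (w + Real.pi * Complex.I) (by rw [im_add_pi_mul_I]; linarith)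
      (by rw [im_add_pi_mul_I]; linarith)).congr_right ?_
    filter_upwards [hφ.odd (Complex.exp w) (Complex.exp_ne_zero w)] with ξ hξ
    rw [exp_add_pi_mul_I, hξ, mul_neg]

theorem IsIncomingFamily.eqOn (hφ : IsGlobalPhase Z μ φ) (hv : IsIncomingFamily Z μ φ v)
    (hv' : IsIncomingFamily Z μ φ v') (ξ : ℝ) : Set.EqOn (v ξ) (v' ξ) incomingDomain := by
  have hpi := Real.pi_pos
  refine eqOn_strip_of_eq_on_line (c := 0) (by linarith) hpi (hv.analytic ξ) (hv'.analytic ξ)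
    fun w hw => ?_
  have h_mem := commonDomain_subset_incomingDomain (mem_commonDomain_of_im_eq_zero hw)
  have h_asymp := hv.asymptotics w (by linarith) hw.le
  have h_asymp' := hv'.asymptotics w (by linarith) hw.le
  rw [exp_of_im_eq_zero hw] at h_asymp h_asymp'
  exact congrFun ((hv.solution w h_mem).isSchrodingerSolution.eq_of_isEquivalent_wave
    (continuous_radialCoeff _ _ _) (Real.exp_pos w.re).ne' (hφ.hasWavenumber (Real.exp_pos _))
    (hv'.solution w h_mem).isSchrodingerSolution h_asymp h_asymp') ξ

theorem IsIncomingFamily.radialWronskian_outgoing (hφ : IsGlobalPhase Z μ φ)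
    (hv : IsIncomingFamily Z μ φ v) (hv' : IsOutgoingFamily Z μ φ v') (ξ : ℝ) {w : ℂ}
    (hw : w ∈ commonDomain) :
    radialWronskian (fun ξ => v ξ w) (fun ξ => v' ξ w) ξ = 2 * Complex.I * Complex.exp w := by
  have hpi := Real.pi_pos
  have h_out := commonDomain_subset_outgoingDomain
  have h_in := commonDomain_subset_incomingDomain
  refine eqOn_strip_of_eq_on_line (c := 0)
    (f := fun w => radialWronskian (fun ξ => v ξ w) (fun ξ => v' ξ w) ξ)
    (g := fun w => 2 * Complex.I * Complex.exp w) (by linarith) hpi ?_ (fun w _ => by fun_prop)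
    (fun w hw => ?_) hw
  · exact (((hv.analytic ξ).mono h_in).mul ((hv'.analytic_deriv ξ).mono h_out)).sub
      (((hv.analytic_deriv ξ).mono h_in).mul ((hv'.analytic ξ).mono h_out))
  · have h_mem := mem_commonDomain_of_im_eq_zero hw
    have h_asymp := hv.asymptotics w (by linarith) hw.le
    have h_asymp' := hv'.asymptotics w hw.ge (by linarith)
    rw [exp_of_im_eq_zero hw] at h_asymp h_asymp'
    rw [(hv.solution w (h_in h_mem)).isSchrodingerSolution.radialWronskian_of_opposite_waves
      (Real.exp_pos w.re).ne' (hφ.hasWavenumber (Real.exp_pos _))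
      (hv'.solution w (h_out h_mem)).isSchrodingerSolution h_asymp h_asymp' ξ,
      exp_of_im_eq_zero hw]

theorem incoming_eq_outgoing (hφ : IsGlobalPhase Z μ φ)
    (hout : IsOutgoingFamily Z μ φ (outgoing Z μ φ)) {w : ℂ} (hw : w ∈ incomingDomain) (ξ : ℝ) :
    incoming Z μ φ ξ w = outgoing Z μ φ ξ (w + Real.pi * Complex.I) := by
  have h_shift := hout.isIncomingFamily hφ
  have h_exists : ∃ v, IsIncomingFamily Z μ φ v := ⟨_, h_shift⟩
  have hin : IsIncomingFamily Z μ φ (incoming Z μ φ) := by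
    rw [incoming, dif_pos h_exists]
    exact h_exists.choose_spec
  exact hin.eqOn hφ h_shift ξ hw

/-! ### Jost functions -/

theorem wronskian_comp_log {f g : ℝ → ℂ} {x : ℝ} (hx : -1 < x)
    (hf : DifferentiableAt ℝ f (Real.log (x + 1)))
    (hg : DifferentiableAt ℝ g (Real.log (x + 1))) :
    wronskian (fun x => f (Real.log (x + 1))) (fun x => g (Real.log (x + 1))) x
      = radialWronskian f g (Real.log (x + 1)) := by
  have hx_ne : x + 1 ≠ 0 := by linarith
  have h_log : HasDerivAt (fun x : ℝ => Real.log (x + 1)) (x + 1)⁻¹ x := by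
    simpa only [id, one_div] using ((hasDerivAt_id x).add_const 1).log hx_ne
  have hx_ne' : ((x + 1 : ℝ) : ℂ) ≠ 0 := Complex.ofReal_ne_zero.2 hx_ne
  have h_comp : ∀ h : ℝ → ℂ, DifferentiableAt ℝ h (Real.log (x + 1)) →
      deriv (fun x => h (Real.log (x + 1))) x
        = ((x + 1 : ℝ) : ℂ)⁻¹ * deriv h (Real.log (x + 1)) := fun h hh => by
    rw [← Complex.ofReal_inv, ← Complex.real_smul]
    exact (hh.hasDerivAt.scomp x h_log).deriv
  rw [wronskian, radialWronskian, h_comp f hf, h_comp g hg]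
  field_simp

theorem isRegularSolution_regular {w : ℂ} (hf : jostPlus Z μ φ w ≠ 0) :
    IsRegularSolution Z μ (Complex.exp w) (regular Z μ (Complex.exp w)) := by
  by_cases h_exists : ∃ v, IsRegularSolution Z μ (Complex.exp w) v
  · rw [regular, dif_pos h_exists]
    exact h_exists.choose_spec
  · refine absurd ?_ hf
    simp [jostPlus, wronskian, regularX, regular, dif_neg h_exists]

theorem isOutgoingFamily_outgoing {w : ℂ} (hf : jostPlus Z μ φ w ≠ 0) :
    IsOutgoingFamily Z μ φ (outgoing Z μ φ) := by
  by_cases h_exists : ∃ v, IsOutgoingFamily Z μ φ v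
  · rw [outgoing, dif_pos h_exists]
    exact h_exists.choose_spec
  · refine absurd ?_ hf
    simp [jostPlus, wronskian, outgoingX, outgoing, dif_neg h_exists]

theorem jostPlus_eq_radialWronskian (hout : IsOutgoingFamily Z μ φ (outgoing Z μ φ)) {w : ℂ}
    (hw : w ∈ outgoingDomain)
    (hreg : IsRegularSolution Z μ (Complex.exp w) (regular Z μ (Complex.exp w))) (ξ : ℝ) :
    jostPlus Z μ φ w
      = radialWronskian (fun ξ => outgoing Z μ φ ξ w) (regular Z μ (Complex.exp w)) ξ := by
  have h_sol := (hout.solution w hw).isSchrodingerSolution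
  have h_reg := hreg.solution.isSchrodingerSolution
  rw [h_sol.radialWronskian_eq h_reg ξ (Real.log (0 + 1))]
  exact wronskian_comp_log (by norm_num) (h_sol.differentiable _) (h_reg.differentiable _)

theorem jostMinus_eq_jostPlus_add_pi (hφ : IsGlobalPhase Z μ φ)
    (hout : IsOutgoingFamily Z μ φ (outgoing Z μ φ)) {w : ℂ} (hw : w ∈ incomingDomain) :
    jostMinus Z μ φ w = jostPlus Z μ φ (w + Real.pi * Complex.I) := by
  simp only [jostMinus, jostPlus, incomingX, outgoingX, exp_add_pi_mul_I, regularX_neg,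
    incoming_eq_outgoing hφ hout hw]

theorem outgoingX_mul_jostPlus_sub (hφ : IsGlobalPhase Z μ φ) {w : ℂ} (hw : w ∈ commonDomain)
    (hf : jostPlus Z μ φ w ≠ 0) (x : ℝ) :
    outgoingX Z μ φ x w * jostPlus Z μ φ (w + Real.pi * Complex.I)
        - outgoingX Z μ φ x (w + Real.pi * Complex.I) * jostPlus Z μ φ w
      = 2 * Complex.I * Complex.exp w * regularX Z μ x (Complex.exp w) := by
  have hout := isOutgoingFamily_outgoing hf
  have hreg := isRegularSolution_regular hf
  have hreg_neg : IsRegularSolution Z μ (Complex.exp (w + Real.pi * Complex.I))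
      (regular Z μ (Complex.exp (w + Real.pi * Complex.I))) := by
    rwa [exp_add_pi_mul_I, regular_neg, isRegularSolution_neg_iff]
  have h_mem_neg := add_pi_mul_I_mem_outgoingDomain (commonDomain_subset_incomingDomain hw)
  rw [jostPlus_eq_radialWronskian hout (commonDomain_subset_outgoingDomain hw) hreg
      (Real.log (x + 1)), jostPlus_eq_radialWronskian hout h_mem_neg hreg_neg (Real.log (x + 1)),
    ← (hout.isIncomingFamily hφ).radialWronskian_outgoing hφ hout (Real.log (x + 1)) hw,
    exp_add_pi_mul_I, regular_neg]
  exact radialWronskian_plucker (fun ξ => outgoing Z μ φ ξ w)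
    (fun ξ => outgoing Z μ φ ξ (w + Real.pi * Complex.I)) (regular Z μ (Complex.exp w))
    (Real.log (x + 1))

/-! ### The relations between `k` and `-k` -/

theorem greenFunction_sub_greenFunction_add_pi (hφ : IsGlobalPhase Z μ φ) {w : ℂ}
    (hw : w ∈ commonDomain) (hf : jostPlus Z μ φ w ≠ 0)
    (hf' : jostPlus Z μ φ (w + Real.pi * Complex.I) ≠ 0) (x x' : ℝ) :
    greenFunction Z μ φ x x' w - greenFunction Z μ φ x x' (w + Real.pi * Complex.I)
      = 2 * Complex.I * Complex.exp w * genEigenfunction Z μ φ (min x x') w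
          * genEigenfunction Z μ φ (max x x') (w + Real.pi * Complex.I) := by
  simp only [greenFunction, genEigenfunction, exp_add_pi_mul_I, regularX_neg]
  field_simp
  linear_combination
    regularX Z μ (min x x') (Complex.exp w) * outgoingX_mul_jostPlus_sub hφ hw hf (max x x')

theorem scatteringElement_add_pi_sub_pi (hφ : IsGlobalPhase Z μ φ)
    (hout : IsOutgoingFamily Z μ φ (outgoing Z μ φ)) {w : ℂ} (hw : w ∈ commonDomain) :
    scatteringElement Z μ φ (w + Real.pi * Complex.I) (w - Real.pi * Complex.I)
      = (scatteringElement Z μ φ w w)⁻¹ := by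
  have h_mem : w - Real.pi * Complex.I ∈ incomingDomain := by
    have h_im : (w - Real.pi * Complex.I).im = w.im - Real.pi := by simp
    constructor <;> rw [h_im] <;> linarith [hw.1, hw.2, Real.pi_pos]
  rw [scatteringElement, scatteringElement, jostMinus_eq_jostPlus_add_pi hφ hout h_mem,
    jostMinus_eq_jostPlus_add_pi hφ hout (commonDomain_subset_incomingDomain hw), sub_add_cancel,
    inv_div]

theorem scatteringElement_mul_genEigenfunction_add_pi (hφ : IsGlobalPhase Z μ φ)
    (hout : IsOutgoingFamily Z μ φ (outgoing Z μ φ)) {w : ℂ} (hw : w ∈ incomingDomain)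
    (hf' : jostPlus Z μ φ (w + Real.pi * Complex.I) ≠ 0) (x : ℝ) :
    scatteringElement Z μ φ w w * genEigenfunction Z μ φ x (w + Real.pi * Complex.I)
      = genEigenfunction Z μ φ x w := by
  rw [scatteringElement, genEigenfunction, genEigenfunction, exp_add_pi_mul_I, regularX_neg,
    jostMinus_eq_jostPlus_add_pi hφ hout hw]
  field_simp

end Families

theorem pt_mem_commonDomain {k : ℂ} (h_lower : -Real.pi < k.arg) (h_upper : k.arg < Real.pi) :
    pt k ∈ commonDomain := by
  simpa only [commonDomain, Set.mem_ofPred_eq, pt, Complex.log_im] using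
    And.intro h_lower h_upper

end TwoCenter

theorem lemma4p11 (Z : ℝ) (μ : ℂ) (φ : ℝ → ℂ → ℂ) (hφ : TwoCenter.IsGlobalPhase Z μ φ)
    (α β : ℝ) (hα : α ∈ Set.Ico 0 Real.pi) (hβ : β ∈ Set.Ico 0 Real.pi)
    (k : ℂ) (hk : k ≠ 0) (hβk : -β < Complex.arg k) (hkα : Complex.arg k < α)
    (hf : TwoCenter.jostPlus Z μ φ (TwoCenter.pt k) ≠ 0)
    (hf' : TwoCenter.jostPlus Z μ φ (TwoCenter.negPtOut k) ≠ 0) :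
    (∀ x x' : ℝ, 0 < x → 0 < x' →
      TwoCenter.greenFunction Z μ φ x x' (TwoCenter.pt k)
          - TwoCenter.greenFunction Z μ φ x x' (TwoCenter.negPtOut k)
        = 2 * Complex.I * k * TwoCenter.genEigenfunction Z μ φ (min x x') (TwoCenter.pt k)
            * TwoCenter.genEigenfunction Z μ φ (max x x') (TwoCenter.negPtOut k)) ∧
    TwoCenter.scatteringElement Z μ φ (TwoCenter.negPtOut k) (TwoCenter.negPtIn k)
      = (TwoCenter.scatteringElement Z μ φ (TwoCenter.pt k) (TwoCenter.pt k))⁻¹ ∧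
    (∀ x : ℝ, 0 < x →
      TwoCenter.scatteringElement Z μ φ (TwoCenter.pt k) (TwoCenter.pt k)
          * TwoCenter.genEigenfunction Z μ φ x (TwoCenter.negPtOut k)
        = TwoCenter.genEigenfunction Z μ φ x (TwoCenter.pt k)) := by
  have hw := TwoCenter.pt_mem_commonDomain (k := k) (by linarith [hβ.2]) (by linarith [hα.2])
  have hout := TwoCenter.isOutgoingFamily_outgoing hf
  have hexp : Complex.exp (TwoCenter.pt k) = k := Complex.exp_log hk
  refine ⟨fun x x' _ _ => ?_, TwoCenter.scatteringElement_add_pi_sub_pi hφ hout hw, fun x _ =>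
    TwoCenter.scatteringElement_mul_genEigenfunction_add_pi hφ hout
      (TwoCenter.commonDomain_subset_incomingDomain hw) hf' x⟩
  have h_green := TwoCenter.greenFunction_sub_greenFunction_add_pi hφ hw hf hf' x x'
  rwa [hexp] at h_green
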